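/- Let $\mathcal{O}_2$ be the Cuntz algebra on two generators, i.e. the universal unital C*-algebra generated by two isometries $S_1,S_2$ with $S_1S_1^*+S_2S_2^*=1$, and let $\sigma$ be the unique *-automorphism of $\mathcal{O}_2$ with $\sigma(S_1)=S_2$ and $\sigma(S_2)=S_1$, so that $\sigma^2=\mathrm{id}$. Let $[\mathcal{O}_2]_1=\{a\in\mathcal{O}_2:\sigma(a)=a\}$ be the fixed-point C*-algebra of $\sigma$. Let $\mathcal{O}_2\rtimes_\sigma\mathbb{Z}_2$ be the crossed product, i.e. the universal unital C*-algebra generated by a copy of $\mathcal{O}_2$ and a unitary $w$ with $w^2=1$ and $wa=\sigma(a)w$ for all $a\in\mathcal{O}_2$, and let $\iota:\mathcal{O}_2\to\mathcal{O}_2\rtimes_\sigma\mathbb{Z}_2$ be the canonical *-homomorphism. Then there is a *-isomorphism $\tau:\mathcal{O}_2\rtimes_\sigma\mathbb{Z}_2\to\mathcal{O}_2$ such that $\tau(\iota(\mathcal{O}_2))=[\mathcal{O}_2]_1$. Moreover, $\tau$ identifies the crossed-product embedding with the fixed-point embedding: there is a *-isomorphism $\theta:\mathcal{O}_2\to[\mathcal{O}_2]_1$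 such that $j\circ\theta=\tau\circ\iota$, where $j:[\mathcal{O}_2]_1\to\mathcal{O}_2$ is the inclusion (in particular, $\iota$ is injective). -/

import Mathlib

open UniformSpace

/-! ### The free complex *-algebra on a set of generators -/

/-- The free unital complex *-algebra on `X`: noncommutative polynomials in the letters
`x` (the pair `(x, false)`) and `x*` (the pair `(x, true)`), `x ∈ X`. -/
def FreeStarAlgebra (X : Type*) : Type _ := FreeAlgebra ℂ (X × Bool)

namespace FreeStarAlgebra

variable {X : Type*}

noncomputable instance : Ring (FreeStarAlgebra X) :=
  inferInstanceAs (Ring (FreeAlgebra ℂ (X × Bool)))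

noncomputable instance : Algebra ℂ (FreeStarAlgebra X) :=
  inferInstanceAs (Algebra ℂ (FreeAlgebra ℂ (X × Bool)))

/-- The letters `x` and `x*`. -/
noncomputable def letter (y : X × Bool) : FreeStarAlgebra X := FreeAlgebra.ι ℂ y

/-- The generator attached to `x`. -/
noncomputable def of (x : X) : FreeStarAlgebra X := letter (x, false)

theorem induction {motive : FreeStarAlgebra X → Prop}
    (scalar : ∀ c : ℂ, motive (algebraMap ℂ _ c)) (letter : ∀ y, motive (letter y))
    (mul : ∀ a b, motive a → motive b → motive (a * b))
    (add : ∀ a b, motive a → motive b → motive (a + b)) (a : FreeStarAlgebra X) : motive a :=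
  FreeAlgebra.induction (R := ℂ) (X := X × Bool) (motive := motive) scalar letter mul add a

/-- The algebra of `FreeStarAlgebra X`, opposite multiplication, conjugate scalar action. -/
noncomputable abbrev conjOpAlgebra (X : Type*) : Algebra ℂ (FreeStarAlgebra X)ᵐᵒᵖ :=
  Algebra.compHom _ (starRingEnd ℂ)

/-- The conjugate-linear anti-homomorphism that exchanges `x` and `x*`. -/
noncomputable def starAux : FreeStarAlgebra X →+* (FreeStarAlgebra X)ᵐᵒᵖ :=
  RingHomClass.toRingHom
    (@FreeAlgebra.lift ℂ (X × Bool) _ (FreeStarAlgebra X)ᵐᵒᵖ _ (conjOpAlgebra X)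
      (fun y => MulOpposite.op (letter (y.1, !y.2))))

theorem starAux_letter (y : X × Bool) :
    starAux (letter y) = MulOpposite.op (letter (y.1, !y.2)) :=
  @FreeAlgebra.lift_ι_apply ℂ (X × Bool) _ (FreeStarAlgebra X)ᵐᵒᵖ _ (conjOpAlgebra X) _ y

theorem starAux_algebraMap (c : ℂ) :
    starAux (algebraMap ℂ (FreeStarAlgebra X) c) =
      MulOpposite.op (algebraMap ℂ (FreeStarAlgebra X) (star c)) :=
  @AlgHom.commutes ℂ (FreeAlgebra ℂ (X × Bool)) (FreeStarAlgebra X)ᵐᵒᵖ _ _ _ _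
    (conjOpAlgebra X) (@FreeAlgebra.lift ℂ (X × Bool) _ (FreeStarAlgebra X)ᵐᵒᵖ _ (conjOpAlgebra X)
      (fun y => MulOpposite.op (letter (y.1, !y.2)))) c

/-- The involution: conjugate-linear, reverses products, exchanges `x` and `x*`. -/
noncomputable instance : StarRing (FreeStarAlgebra X) where
  star a := (starAux a).unop
  star_involutive a := by
    refine induction (motive := fun a => (starAux (starAux a).unop).unop = a) ?_ ?_ ?_ ?_ a
    · intro c; simp [starAux_algebraMap]
    · intro y; simp [starAux_letter]
    · intro a b ha hb; simp [ha, hb]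
    · intro a b ha hb; simp [ha, hb]
  star_mul a b := by simp
  star_add a b := by simp

theorem star_letter (y : X × Bool) : star (letter y) = letter (y.1, !y.2) :=
  congrArg MulOpposite.unop (starAux_letter y)

theorem star_algebraMap' (c : ℂ) :
    star (algebraMap ℂ (FreeStarAlgebra X) c) = algebraMap ℂ (FreeStarAlgebra X) (star c) :=
  congrArg MulOpposite.unop (starAux_algebraMap c)

instance : StarModule ℂ (FreeStarAlgebra X) where
  star_smul c a := by
    rw [Algebra.smul_def, star_mul, star_algebraMap', Algebra.smul_def, Algebra.commutes]

/-- Evaluation of *-polynomials at a family `f` of elements of a complex *-algebra. -/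
noncomputable def lift {B : Type*} [Ring B] [StarRing B] [Algebra ℂ B] [StarModule ℂ B]
    (f : X → B) : FreeStarAlgebra X →⋆ₐ[ℂ] B :=
  let φ : FreeStarAlgebra X →ₐ[ℂ] B :=
    FreeAlgebra.lift ℂ (fun y : X × Bool => if y.2 then star (f y.1) else f y.1)
  have hφ : ∀ y, φ (letter y) = if y.2 then star (f y.1) else f y.1 := fun y =>
    FreeAlgebra.lift_ι_apply _ y
  { φ with
    map_star' := fun a => by
      change φ (star a) = star (φ a)
      refine induction (motive := fun a => φ (star a) = star (φ a)) ?_ ?_ ?_ ?_ a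
      · intro c
        rw [star_algebraMap', AlgHom.commutes, AlgHom.commutes, algebraMap_star_comm]
      · rintro ⟨x, b⟩
        rw [star_letter, hφ, hφ]
        cases b <;> simp
      · intro a b ha hb; simp [ha, hb]
      · intro a b ha hb; simp [ha, hb] }

theorem lift_of {B : Type*} [Ring B] [StarRing B] [Algebra ℂ B] [StarModule ℂ B]
    (f : X → B) (x : X) : lift f (of x) = f x :=
  FreeAlgebra.lift_ι_apply (R := ℂ) (fun y : X × Bool => if y.2 then star (f y.1) else f y.1)
    (x, false)

end FreeStarAlgebra

/-! ### Universal C*-algebras given by generators and relations -/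

/-- C*-seminorms on a complex *-algebra. -/
structure IsCStarSeminorm {F : Type*} [Ring F] [StarRing F] [Algebra ℂ F]
    (p : Seminorm ℂ F) : Prop where
  mul_le : ∀ a b, p (a * b) ≤ p a * p b
  star_mul_self : ∀ a, p (star a * a) = p a ^ 2

namespace IsCStarSeminorm

variable {F : Type*} [Ring F] [StarRing F] [Algebra ℂ F] {p : Seminorm ℂ F}

theorem star_eq (hp : IsCStarSeminorm p) (a : F) : p (star a) = p a := by
  have key : ∀ b : F, p b ≤ p (star b) := fun b => by
    have h1 := hp.star_mul_self b
    have h2 := hp.mul_le (star b) b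
    have h3 := apply_nonneg p b
    have h4 := apply_nonneg p (star b)
    by_contra! h
    nlinarith
  exact le_antisymm (by simpa using key (star a)) (key a)

theorem one_le (hp : IsCStarSeminorm p) : p 1 ≤ 1 := by
  have h := hp.star_mul_self 1
  rw [star_one, one_mul] at h
  by_contra! h'
  nlinarith

theorem le_one_of_star_mul_self (hp : IsCStarSeminorm p) {a : F} (h : p (star a * a) ≤ 1) :
    p a ≤ 1 := by
  rw [hp.star_mul_self] at h
  exact (sq_le_one_iff₀ (apply_nonneg p a)).1 h

/-- A C*-seminorm on a C*-algebra is dominated by (twice) the norm. -/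
theorem le_two_mul_norm {A : Type*} [CStarAlgebra A] {p : Seminorm ℂ A} (hp : IsCStarSeminorm p) (a : A) :
    p a ≤ 2 * ‖a‖ := by
  obtain ⟨u, c, hx, hc⟩ := CStarAlgebra.exists_sum_four_unitary a
  have hu : ∀ i, p (u i : A) ≤ 1 := fun i =>
    hp.le_one_of_star_mul_self (by rw [Unitary.coe_star_mul_self]; exact hp.one_le)
  calc p a = p (∑ i, c i • (u i : A)) := by rw [← hx]
    _ ≤ ∑ i, p (c i • (u i : A)) := Finset.le_sum_of_subadditive p (map_zero p).le (map_add_le_add p) _ _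
    _ ≤ ∑ _i : Fin 4, ‖a‖ / 2 := Finset.sum_le_sum fun i _ => by
        rw [map_smul_eq_mul]
        have := hc i
        have := hu i
        have := apply_nonneg p (u i : A)
        have := norm_nonneg (c i)
        nlinarith
    _ = 2 * ‖a‖ := by simp; ring

/-- The seminorm of a *-homomorphism into a C*-algebra. -/
noncomputable def ofHom {B : Type*} [CStarAlgebra B] (φ : F →⋆ₐ[ℂ] B) : Seminorm ℂ F :=
  (normSeminorm ℂ B).comp φ.toAlgHom.toLinearMap

theorem isCStarSeminorm_ofHom {B : Type*} [CStarAlgebra B] (φ : F →⋆ₐ[ℂ] B) :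
    IsCStarSeminorm (ofHom φ) where
  mul_le a b := by
    change ‖φ (a * b)‖ ≤ ‖φ a‖ * ‖φ b‖
    rw [map_mul]; exact norm_mul_le _ _
  star_mul_self a := by
    change ‖φ (star a * a)‖ = ‖φ a‖ ^ 2
    rw [map_mul, map_star, CStarRing.norm_star_mul_self, sq]

end IsCStarSeminorm

section Universal

variable {X : Type*}

/-- The C*-seminorms on the free *-algebra that vanish on the relations `R`. -/
abbrev RelSeminorm (R : Set (FreeStarAlgebra X)) : Type _ :=
  {p : Seminorm ℂ (FreeStarAlgebra X) // IsCStarSeminorm p ∧ ∀ r ∈ R, p r = 0}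

noncomputable instance (R : Set (FreeStarAlgebra X)) : Inhabited (RelSeminorm R) :=
  ⟨⟨0, ⟨fun _ _ => by simp, fun _ => by simp⟩, fun _ _ => rfl⟩⟩

/-- Admissible relations: each generator is uniformly bounded over all C*-seminorms that vanish
on the relations. This is the condition under which the universal C*-algebra exists. -/
class AdmissibleRelations (R : Set (FreeStarAlgebra X)) : Prop where
  bounded : ∀ x : X, ∃ C : ℝ, ∀ p : RelSeminorm R, p.1 (FreeStarAlgebra.of x) ≤ C

theorem RelSeminorm.bddAbove (R : Set (FreeStarAlgebra X)) [AdmissibleRelations R]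
    (a : FreeStarAlgebra X) : BddAbove (Set.range fun p : RelSeminorm R => p.1 a) := by
  suffices h : ∃ C : ℝ, ∀ p : RelSeminorm R, p.1 a ≤ C by
    obtain ⟨C, hC⟩ := h
    exact ⟨C, by rintro _ ⟨p, rfl⟩; exact hC p⟩
  induction a using FreeStarAlgebra.induction with
  | scalar c =>
    refine ⟨‖c‖, fun p => ?_⟩
    rw [Algebra.algebraMap_eq_smul_one, map_smul_eq_mul]
    exact mul_le_of_le_one_right (norm_nonneg c) p.2.1.one_le
  | letter y =>
    obtain ⟨C, hC⟩ := AdmissibleRelations.bounded (R := R) y.1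
    refine ⟨C, fun p => ?_⟩
    obtain ⟨x, b⟩ := y
    cases b
    · exact hC p
    · rw [← p.2.1.star_eq, FreeStarAlgebra.star_letter]
      exact hC p
  | mul a b ha hb =>
    obtain ⟨C, hC⟩ := ha
    obtain ⟨D, hD⟩ := hb
    refine ⟨C * D, fun p => (p.2.1.mul_le a b).trans ?_⟩
    exact mul_le_mul (hC p) (hD p) (apply_nonneg _ _) ((apply_nonneg _ _).trans (hC p))
  | add a b ha hb =>
    obtain ⟨C, hC⟩ := ha
    obtain ⟨D, hD⟩ := hb
    exact ⟨C + D, fun p => (map_add_le_add p.1 a b).trans (add_le_add (hC p) (hD p))⟩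

/-- The free *-algebra on `X`, with the universal seminorm `‖a‖ = sup p(a)` over all C*-seminorms
`p` that vanish on `R`. -/
def PreUniversal (R : Set (FreeStarAlgebra X)) : Type _ := FreeStarAlgebra X

namespace PreUniversal

variable (R : Set (FreeStarAlgebra X))

noncomputable instance : Ring (PreUniversal R) := inferInstanceAs (Ring (FreeStarAlgebra X))

noncomputable instance : StarRing (PreUniversal R) :=
  inferInstanceAs (StarRing (FreeStarAlgebra X))

noncomputable instance : Algebra ℂ (PreUniversal R) :=
  inferInstanceAs (Algebra ℂ (FreeStarAlgebra X))

instance : StarModule ℂ (PreUniversal R) := inferInstanceAs (StarModule ℂ (FreeStarAlgebra X))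

noncomputable instance : Norm (PreUniversal R) where
  norm a := ⨆ p : RelSeminorm R, p.1 a

theorem norm_def (a : PreUniversal R) : ‖a‖ = ⨆ p : RelSeminorm R, p.1 a := rfl

theorem norm_le {a : PreUniversal R} {C : ℝ} (h : ∀ p : RelSeminorm R, p.1 a ≤ C) : ‖a‖ ≤ C :=
  ciSup_le h

theorem norm_star' (a : PreUniversal R) : ‖star a‖ = ‖a‖ :=
  congrArg iSup (funext fun p : RelSeminorm R => p.2.1.star_eq a)

variable [AdmissibleRelations R]

theorem le_norm (p : RelSeminorm R) (a : PreUniversal R) : p.1 a ≤ ‖a‖ :=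
  le_ciSup (RelSeminorm.bddAbove R a) p

theorem norm_nonneg' (a : PreUniversal R) : 0 ≤ ‖a‖ :=
  (apply_nonneg (default : RelSeminorm R).1 a).trans (le_norm R default a)

noncomputable instance : SeminormedRing (PreUniversal R) :=
  { (AddGroupSeminorm.toSeminormedAddGroup
      { toFun := fun a : PreUniversal R => ‖a‖
        map_zero' := le_antisymm (norm_le R fun p => (map_zero p.1).le) (norm_nonneg' R 0)
        add_le' := fun a b => norm_le R fun p =>
          (map_add_le_add p.1 a b).trans (add_le_add (le_norm R p a) (le_norm R p b))
        neg' := fun a => congrArg iSup (funext fun p : RelSeminorm R => map_neg_eq_map p.1 a) } :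
        SeminormedAddGroup (PreUniversal R)),
    (inferInstance : Ring (PreUniversal R)) with
    norm_mul_le := fun a b => norm_le R fun p => (p.2.1.mul_le a b).trans
      (mul_le_mul (le_norm R p a) (le_norm R p b) (apply_nonneg _ _) (norm_nonneg' R a)) }

noncomputable instance : NormedAlgebra ℂ (PreUniversal R) where
  norm_smul_le c a := norm_le R fun p => by
    rw [show p.1 (c • a) = ‖c‖ * p.1 a from map_smul_eq_mul p.1 c a]
    exact mul_le_mul_of_nonneg_left (le_norm R p a) (_root_.norm_nonneg c)

theorem norm_mul_self_le' (a : PreUniversal R) : ‖a‖ * ‖a‖ ≤ ‖star a * a‖ := by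
  rw [← sq]
  refine (Real.le_sqrt (norm_nonneg' R a) (norm_nonneg' R _)).1 (norm_le R fun p => ?_)
  refine Real.le_sqrt_of_sq_le ?_
  exact (p.2.1.star_mul_self a).symm.trans_le (le_norm R p (star a * a : PreUniversal R))

theorem isometry_star : Isometry (star : PreUniversal R → PreUniversal R) :=
  AddMonoidHomClass.isometry_of_norm (starAddEquiv : PreUniversal R ≃+ PreUniversal R)
    (norm_star' R)

end PreUniversal

/-- The universal (unital) C*-algebra generated by `X` subject to the relations `r = 0`, `r ∈ R`:
the Hausdorff completion of the free *-algebra in the universal seminorm. -/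
def UniversalCStarAlgebra (R : Set (FreeStarAlgebra X)) [AdmissibleRelations R] : Type _ :=
  Completion (PreUniversal R)

namespace UniversalCStarAlgebra

variable (R : Set (FreeStarAlgebra X)) [AdmissibleRelations R]

noncomputable instance : NormedRing (UniversalCStarAlgebra R) :=
  inferInstanceAs (NormedRing (Completion (PreUniversal R)))

instance : CompleteSpace (UniversalCStarAlgebra R) :=
  inferInstanceAs (CompleteSpace (Completion (PreUniversal R)))

noncomputable instance : Algebra ℂ (UniversalCStarAlgebra R) :=
  inferInstanceAs (Algebra ℂ (Completion (PreUniversal R)))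

noncomputable instance : NormedAlgebra ℂ (UniversalCStarAlgebra R) where
  norm_smul_le c a := norm_smul_le (β := Completion (PreUniversal R)) c a

/-- The canonical map of the free *-algebra into the universal C*-algebra. -/
noncomputable def coe (a : FreeStarAlgebra X) : UniversalCStarAlgebra R :=
  ((show PreUniversal R from a : PreUniversal R) : Completion (PreUniversal R))

theorem coe_add (a b : FreeStarAlgebra X) : coe R (a + b) = coe R a + coe R b :=
  Completion.coe_add (α := PreUniversal R) a b

theorem coe_mul (a b : FreeStarAlgebra X) : coe R (a * b) = coe R a * coe R b :=
  Completion.coe_mul (α := PreUniversal R) a b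

theorem coe_smul (c : ℂ) (a : FreeStarAlgebra X) : coe R (c • a) = c • coe R a :=
  Completion.coe_smul (X := PreUniversal R) c a

theorem norm_coe (a : FreeStarAlgebra X) : ‖coe R a‖ = ⨆ p : RelSeminorm R, p.1 a :=
  Completion.norm_coe (E := PreUniversal R) a

theorem denseRange_coe : DenseRange (coe R) := Completion.denseRange_coe (α := PreUniversal R)

theorem induction_on {motive : UniversalCStarAlgebra R → Prop} (a : UniversalCStarAlgebra R)
    (closed : IsClosed {a | motive a}) (coe : ∀ a, motive (coe R a)) : motive a :=
  Completion.induction_on (α := PreUniversal R) a closed coe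

noncomputable instance : Star (UniversalCStarAlgebra R) where
  star := Completion.map (star : PreUniversal R → PreUniversal R)

theorem star_coe (a : FreeStarAlgebra X) : star (coe R a) = coe R (star a) :=
  Completion.map_coe (α := PreUniversal R) (PreUniversal.isometry_star R).uniformContinuous a

theorem continuous_star' : Continuous (star : UniversalCStarAlgebra R → UniversalCStarAlgebra R) :=
  Completion.continuous_map (α := PreUniversal R)

/-- The involution, extended by continuity. -/
noncomputable instance : StarRing (UniversalCStarAlgebra R) where
  star_involutive a := by
    induction a using induction_on with
    | closed =>
      exact isClosed_eq ((continuous_star' R).comp (continuous_star' R)) continuous_id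
    | coe a => rw [star_coe, star_coe, star_star]
  star_mul a b := by
    induction a using induction_on with
    | closed =>
      exact isClosed_eq ((continuous_star' R).comp (continuous_id.mul continuous_const))
        (continuous_const.mul (continuous_star' R))
    | coe a =>
      induction b using induction_on with
      | closed =>
        exact isClosed_eq ((continuous_star' R).comp (continuous_const.mul continuous_id))
          ((continuous_star' R).mul continuous_const)
      | coe b => rw [← coe_mul, star_coe, star_coe, star_coe, star_mul, coe_mul]
  star_add a b := by
    induction a using induction_on with
    | closed =>
      exact isClosed_eq ((continuous_star' R).comp (continuous_id.add continuous_const))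
        ((continuous_star' R).add continuous_const)
    | coe a =>
      induction b using induction_on with
      | closed =>
        exact isClosed_eq ((continuous_star' R).comp (continuous_const.add continuous_id))
          (continuous_const.add (continuous_star' R))
      | coe b => rw [← coe_add, star_coe, star_coe, star_coe, star_add, coe_add]

instance : CStarRing (UniversalCStarAlgebra R) where
  norm_mul_self_le a := by
    induction a using induction_on with
    | closed =>
      exact isClosed_le (continuous_norm.mul continuous_norm)
        (continuous_norm.comp ((continuous_star' R).mul continuous_id))
    | coe a =>
      rw [star_coe, ← coe_mul, norm_coe, norm_coe]
      exact PreUniversal.norm_mul_self_le' R a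

instance : StarModule ℂ (UniversalCStarAlgebra R) where
  star_smul c a := by
    induction a using induction_on with
    | closed =>
      exact isClosed_eq ((continuous_star' R).comp (continuous_id.const_smul c))
        ((continuous_star' R).const_smul (star c))
    | coe a => rw [← coe_smul, star_coe, star_coe, star_smul, coe_smul]

noncomputable instance : CStarAlgebra (UniversalCStarAlgebra R) where

/-- `coe` as a unital *-homomorphism. -/
noncomputable def coeHom : FreeStarAlgebra X →⋆ₐ[ℂ] UniversalCStarAlgebra R where
  toFun := coe R
  map_one' := Completion.coe_one (α := PreUniversal R)
  map_mul' := coe_mul R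
  map_zero' := Completion.coe_zero (α := PreUniversal R)
  map_add' := coe_add R
  commutes' _ := rfl
  map_star' a := (star_coe R a).symm

/-- The generators of the universal C*-algebra. -/
noncomputable def of (x : X) : UniversalCStarAlgebra R := coeHom R (FreeStarAlgebra.of x)

/-- The relations hold in the universal C*-algebra. -/
theorem coeHom_eq_zero {r : FreeStarAlgebra X} (hr : r ∈ R) : coeHom R r = 0 := by
  rw [← norm_eq_zero]
  refine (norm_coe R r).trans ?_
  rw [iSup_congr fun p : RelSeminorm R => p.2.2 r hr, ciSup_const]

theorem coeHom_eq {a b : FreeStarAlgebra X} (hr : a - b ∈ R) : coeHom R a = coeHom R b := by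
  rw [← sub_eq_zero, ← map_sub, coeHom_eq_zero R hr]

variable {R} {B : Type*} [CStarAlgebra B]

/-- The universal property: a family `f` in a C*-algebra that satisfies the relations extends to a
unital *-homomorphism. -/
noncomputable def lift (f : X → B) (hf : ∀ r ∈ R, FreeStarAlgebra.lift f r = 0) :
    UniversalCStarAlgebra R →⋆ₐ[ℂ] B :=
  let φ : PreUniversal R →+* B := RingHomClass.toRingHom (FreeStarAlgebra.lift f)
  have hφ : Continuous φ := AddMonoidHomClass.continuous_of_bound φ 1 fun a => by
    rw [one_mul]
    exact PreUniversal.le_norm R ⟨IsCStarSeminorm.ofHom (FreeStarAlgebra.lift f),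
      IsCStarSeminorm.isCStarSeminorm_ofHom _, fun r hr => by
        change ‖FreeStarAlgebra.lift f r‖ = 0
        rw [hf r hr, norm_zero]⟩ a
  have hcoe : ∀ a, Completion.extensionHom φ hφ (coe R a) = FreeStarAlgebra.lift f a := fun a =>
    Completion.extensionHom_coe φ hφ a
  have hcont : Continuous (fun a : UniversalCStarAlgebra R => Completion.extensionHom φ hφ a) :=
    Completion.continuous_extension
  { (Completion.extensionHom φ hφ : UniversalCStarAlgebra R →+* B) with
    commutes' := fun c => (hcoe (algebraMap ℂ _ c)).trans (AlgHomClass.commutes _ c)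
    map_star' := fun a => by
      let ψ : UniversalCStarAlgebra R → B := Completion.extensionHom φ hφ
      change ψ (star a) = star (ψ a)
      change ∀ a, ψ (coe R a) = _ at hcoe
      induction a using induction_on with
      | closed =>
        exact isClosed_eq (hcont.comp (continuous_star' R)) (continuous_star.comp hcont)
      | coe a => rw [star_coe, hcoe, hcoe, map_star] }

theorem lift_coeHom (f : X → B) (hf : ∀ r ∈ R, FreeStarAlgebra.lift f r = 0)
    (a : FreeStarAlgebra X) : lift f hf (coeHom R a) = FreeStarAlgebra.lift f a :=
  Completion.extensionHom_coe (α := PreUniversal R)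
    (RingHomClass.toRingHom (FreeStarAlgebra.lift f) : PreUniversal R →+* B)
    (AddMonoidHomClass.continuous_of_bound _ 1 fun a => by
      rw [one_mul]
      exact PreUniversal.le_norm R ⟨IsCStarSeminorm.ofHom (FreeStarAlgebra.lift f),
        IsCStarSeminorm.isCStarSeminorm_ofHom _, fun r hr => by
          change ‖FreeStarAlgebra.lift f r‖ = 0
          rw [hf r hr, norm_zero]⟩ a) a

theorem lift_of (f : X → B) (hf : ∀ r ∈ R, FreeStarAlgebra.lift f r = 0) (x : X) :
    lift f hf (of R x) = f x :=
  (lift_coeHom f hf _).trans (FreeStarAlgebra.lift_of f x)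

/-- A *-homomorphism on the universal C*-algebra is determined by the generators. -/
theorem hom_ext {φ ψ : UniversalCStarAlgebra R →⋆ₐ[ℂ] B} (h : ∀ x, φ (of R x) = ψ (of R x)) :
    φ = ψ := by
  have hc : ∀ χ : UniversalCStarAlgebra R →⋆ₐ[ℂ] B, Continuous χ := fun χ =>
    AddMonoidHomClass.continuous_of_bound χ 1 fun a => by
      rw [one_mul]; exact NonUnitalStarAlgHom.norm_apply_le χ a
  refine StarAlgHom.ext fun a => ?_
  induction a using induction_on with
  | closed => exact isClosed_eq (hc φ) (hc ψ)
  | coe a =>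
    change φ (coeHom R a) = ψ (coeHom R a)
    induction a using FreeStarAlgebra.induction with
    | scalar c => simp only [AlgHomClass.commutes]
    | letter y =>
      obtain ⟨x, b⟩ := y
      cases b
      · exact h x
      · rw [← Bool.not_false, ← FreeStarAlgebra.star_letter (x, false), map_star, map_star,
          map_star]
        exact congrArg star (h x)
    | mul a b ha hb => rw [map_mul, map_mul, map_mul, ha, hb]
    | add a b ha hb => rw [map_add, map_add, map_add, ha, hb]

end UniversalCStarAlgebra

end Universal

/-! ### The Cuntz algebra on two generators and its flip -/

section Cuntz

open FreeStarAlgebra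

/-- The relations of `𝒪₂`: `s₀* s₀ = 1`, `s₁* s₁ = 1`, `s₀ s₀* + s₁ s₁* = 1`. -/
def cuntzRelations : Set (FreeStarAlgebra (Fin 2)) :=
  {star (of 0) * of 0 - 1, star (of 1) * of 1 - 1,
    of 0 * star (of 0) + of 1 * star (of 1) - 1}

theorem Seminorm.eq_of_sub_eq_zero' {F : Type*} [AddCommGroup F] [Module ℂ F] (p : Seminorm ℂ F)
    {a b : F} (h : p (a - b) = 0) : p a = p b := by
  have := abs_sub_map_le_sub p a b
  rw [h] at this
  exact sub_eq_zero.1 (abs_nonpos_iff.1 this)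

instance : AdmissibleRelations cuntzRelations where
  bounded x := ⟨1, fun p => p.2.1.le_one_of_star_mul_self <| by
    have h : star (of x) * of x - 1 ∈ cuntzRelations := by
      fin_cases x <;> simp [cuntzRelations]
    rw [p.1.eq_of_sub_eq_zero' (p.2.2 _ h)]
    exact p.2.1.one_le⟩

/-- The Cuntz algebra `𝒪₂`: the universal C*-algebra generated by two isometries `s₀`, `s₁` with
`s₀ s₀* + s₁ s₁* = 1`. -/
abbrev CuntzTwo : Type := UniversalCStarAlgebra cuntzRelations

namespace CuntzTwo

/-- The canonical isometries `s₀`, `s₁`. -/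
noncomputable def s (i : Fin 2) : CuntzTwo := UniversalCStarAlgebra.of cuntzRelations i

theorem star_s_mul_s (i : Fin 2) : star (s i) * s i = 1 := by
  have h : star (of i) * of i - 1 ∈ cuntzRelations := by
    fin_cases i <;> simp [cuntzRelations]
  simpa [map_star] using! UniversalCStarAlgebra.coeHom_eq _ h

theorem s_mul_star_s : s 0 * star (s 0) + s 1 * star (s 1) = 1 := by
  have h : of 0 * star (of 0) + of 1 * star (of 1) - 1 ∈ cuntzRelations := by
    simp [cuntzRelations]
  simpa [map_star] using! UniversalCStarAlgebra.coeHom_eq _ h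

/-- Two isometries `T 0`, `T 1` in a C*-algebra with the Cuntz relation give a unital
*-homomorphism `s i ↦ T i`. -/
noncomputable def lift {B : Type*} [CStarAlgebra B] (T : Fin 2 → B)
    (h₁ : ∀ i, star (T i) * T i = 1) (h₂ : T 0 * star (T 0) + T 1 * star (T 1) = 1) :
    CuntzTwo →⋆ₐ[ℂ] B :=
  UniversalCStarAlgebra.lift T <| by
    rintro r (rfl | rfl | rfl) <;> simp [FreeStarAlgebra.lift_of, map_star, h₁, h₂]

theorem lift_s {B : Type*} [CStarAlgebra B] (T : Fin 2 → B)
    (h₁ : ∀ i, star (T i) * T i = 1) (h₂ : T 0 * star (T 0) + T 1 * star (T 1) = 1) (i : Fin 2) :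
    lift T h₁ h₂ (s i) = T i :=
  UniversalCStarAlgebra.lift_of T _ i

theorem hom_ext {B : Type*} [CStarAlgebra B] {φ ψ : CuntzTwo →⋆ₐ[ℂ] B}
    (h : ∀ i, φ (s i) = ψ (s i)) : φ = ψ :=
  UniversalCStarAlgebra.hom_ext h

/-- The *-endomorphism that exchanges `s₀` and `s₁`. -/
noncomputable def flipHom : CuntzTwo →⋆ₐ[ℂ] CuntzTwo :=
  lift (fun i => s (1 - i)) (fun i => star_s_mul_s _)
    ((add_comm _ _).trans (by simpa using s_mul_star_s))

theorem flipHom_s (i : Fin 2) : flipHom (s i) = s (1 - i) := lift_s _ _ _ i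

theorem flipHom_flipHom (a : CuntzTwo) : flipHom (flipHom a) = a :=
  DFunLike.congr_fun (show flipHom.comp flipHom = StarAlgHom.id ℂ CuntzTwo from
    hom_ext fun i => by simp [flipHom_s]) a

/-- The automorphism `σ` of `𝒪₂` with `σ(s₀) = s₁` and `σ(s₁) = s₀`. -/
noncomputable def σ : CuntzTwo ≃⋆ₐ[ℂ] CuntzTwo :=
  StarAlgEquiv.ofStarAlgHom flipHom flipHom
    (StarAlgHom.ext flipHom_flipHom) (StarAlgHom.ext flipHom_flipHom)

theorem σ_s_zero : σ (s 0) = s 1 := flipHom_s 0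

theorem σ_s_one : σ (s 1) = s 0 := flipHom_s 1

theorem σ_unique (σ' : CuntzTwo ≃⋆ₐ[ℂ] CuntzTwo) (h₀ : σ' (s 0) = s 1) (h₁ : σ' (s 1) = s 0) :
    σ' = σ := by
  have h : (σ' : CuntzTwo →⋆ₐ[ℂ] CuntzTwo) = flipHom := hom_ext fun i => by
    fin_cases i
    · exact h₀.trans σ_s_zero.symm
    · exact h₁.trans σ_s_one.symm
  exact StarAlgEquiv.ext fun a => DFunLike.congr_fun h a

theorem σ_involutive : Function.Involutive σ := flipHom_flipHom

end CuntzTwo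

end Cuntz

/-! ### Crossed products by `ℤ₂` and fixed-point algebras -/

section CrossedProduct

open FreeStarAlgebra

variable {A : Type*} [CStarAlgebra A]

/-- The relations of the crossed product of `A` by the action of `ℤ₂` generated by `σ`. The
generators are a letter `of (some a)` for each `a ∈ A` and a letter `w = of none`; the relations
say that `a ↦ of (some a)` is a unital *-homomorphism and that `w` is a unitary with `w² = 1` and
`w a = σ(a) w`. -/
inductive CrossedRelation (σ : A ≃⋆ₐ[ℂ] A) : FreeStarAlgebra (Option A) → Prop
  | add (a b : A) : CrossedRelation σ (of (some (a + b)) - (of (some a) + of (some b)))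
  | smul (c : ℂ) (a : A) : CrossedRelation σ (of (some (c • a)) - c • of (some a))
  | mul (a b : A) : CrossedRelation σ (of (some (a * b)) - of (some a) * of (some b))
  | star (a : A) : CrossedRelation σ (of (some (star a)) - star (of (some a)))
  | one : CrossedRelation σ (of (some 1) - 1)
  | star_w_mul_w : CrossedRelation σ (star (of none) * of none - 1)
  | w_mul_star_w : CrossedRelation σ (of none * star (of none) - 1)
  | w_mul_w : CrossedRelation σ (of none * of none - 1)
  | covariance (a : A) :
      CrossedRelation σ (of none * of (some a) - of (some (σ a)) * of none)

/-- The set of relations of the crossed product. -/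
def crossedRelations (σ : A ≃⋆ₐ[ℂ] A) : Set (FreeStarAlgebra (Option A)) :=
  {r | CrossedRelation σ r}

instance (σ : A ≃⋆ₐ[ℂ] A) : AdmissibleRelations (crossedRelations σ) where
  bounded x := by
    cases x with
    | none =>
      refine ⟨1, fun p => p.2.1.le_one_of_star_mul_self ?_⟩
      rw [p.1.eq_of_sub_eq_zero' (p.2.2 _ CrossedRelation.star_w_mul_w)]
      exact p.2.1.one_le
    | some a =>
      refine ⟨2 * ‖a‖, fun p => ?_⟩
      have key : ∀ {x y}, x - y ∈ crossedRelations σ → p.1 x = p.1 y := fun h =>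
        p.1.eq_of_sub_eq_zero' (p.2.2 _ h)
      let q : Seminorm ℂ A := Seminorm.of (fun a => p.1 (of (some a)))
        (fun a b => (key (.add a b)).trans_le (map_add_le_add p.1 _ _))
        (fun c a => (key (.smul c a)).trans (map_smul_eq_mul p.1 _ _))
      have hq : IsCStarSeminorm q :=
        { mul_le := fun a b => (key (.mul a b)).trans_le (p.2.1.mul_le _ _)
          star_mul_self := fun a => by
            change p.1 (of (some (star a * a))) = p.1 (of (some a)) ^ 2
            rw [← p.2.1.star_mul_self, key (.mul (star a) a)]
            refine p.1.eq_of_sub_eq_zero' (le_antisymm ?_ (apply_nonneg _ _))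
            rw [← sub_mul]
            refine (p.2.1.mul_le _ _).trans ?_
            rw [p.2.2 _ (.star a), zero_mul] }
      exact hq.le_two_mul_norm a

/-- The C*-crossed product `A ⋊_σ ℤ₂` by an automorphism `σ` with `σ² = 1`: the universal C*-algebra
generated by a copy of `A` and a unitary `w` with `w² = 1` and `w a w* = σ(a)`. -/
def CrossedProduct (σ : A ≃⋆ₐ[ℂ] A) (_hσ : Function.Involutive σ) : Type _ :=
  UniversalCStarAlgebra (crossedRelations σ)

namespace CrossedProduct

open UniversalCStarAlgebra (coeHom)

variable (σ : A ≃⋆ₐ[ℂ] A) (hσ : Function.Involutive σ)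

noncomputable instance : CStarAlgebra (CrossedProduct σ hσ) :=
  inferInstanceAs (CStarAlgebra (UniversalCStarAlgebra (crossedRelations σ)))

theorem rel {σ : A ≃⋆ₐ[ℂ] A} {x y : FreeStarAlgebra (Option A)} (h : CrossedRelation σ (x - y)) :
    coeHom (crossedRelations σ) x = coeHom (crossedRelations σ) y :=
  UniversalCStarAlgebra.coeHom_eq (crossedRelations σ) h

/-- The canonical *-homomorphism `A → A ⋊_σ ℤ₂`; its range is the canonical copy of `A`. -/
noncomputable def ι : A →⋆ₐ[ℂ] CrossedProduct σ hσ where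
  toFun a := UniversalCStarAlgebra.of (crossedRelations σ) (some a)
  map_one' := rel CrossedRelation.one
  map_mul' a b := (rel (CrossedRelation.mul a b)).trans (map_mul _ _ _)
  map_zero' := by
    have h := (rel (CrossedRelation.smul (σ := σ) 0 0)).trans (map_smul _ _ _)
    rw [zero_smul, zero_smul] at h
    exact h
  map_add' a b := (rel (CrossedRelation.add a b)).trans (map_add _ _ _)
  commutes' c := by
    rw [Algebra.algebraMap_eq_smul_one, Algebra.algebraMap_eq_smul_one]
    refine (rel (CrossedRelation.smul (σ := σ) c 1)).trans ((map_smul _ _ _).trans ?_)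
    exact congrArg (c • ·) (rel CrossedRelation.one)
  map_star' a := (rel (CrossedRelation.star a)).trans (map_star _ _)

/-- The canonical unitary `w` of the crossed product. -/
noncomputable def w : CrossedProduct σ hσ := UniversalCStarAlgebra.of (crossedRelations σ) none

theorem w_mem_unitary : w σ hσ ∈ unitary (CrossedProduct σ hσ) :=
  ⟨by simpa [map_star] using! rel (CrossedRelation.star_w_mul_w (σ := σ)),
    by simpa [map_star] using! rel (CrossedRelation.w_mul_star_w (σ := σ))⟩

theorem w_mul_w : w σ hσ * w σ hσ = 1 := by
  simpa using! rel (CrossedRelation.w_mul_w (σ := σ))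

theorem w_mul_ι (a : A) : w σ hσ * ι σ hσ a = ι σ hσ (σ a) * w σ hσ := by
  simpa using! rel (CrossedRelation.covariance (σ := σ) a)

variable {B : Type*} [CStarAlgebra B]

/-- The universal property: a covariant pair `(φ, v)` gives a unital *-homomorphism. -/
noncomputable def lift (φ : A →⋆ₐ[ℂ] B) (v : B) (hv : v ∈ unitary B) (hv₂ : v * v = 1)
    (hcov : ∀ a, v * φ a = φ (σ a) * v) : CrossedProduct σ hσ →⋆ₐ[ℂ] B :=
  UniversalCStarAlgebra.lift (fun x : Option A => x.elim v φ) <| by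
    rintro _ (_ | _ | _ | _ | _ | _ | _ | _ | _) <;>
      simp [FreeStarAlgebra.lift_of, map_star, hv.1, hv.2, hv₂, hcov]

theorem lift_ι (φ : A →⋆ₐ[ℂ] B) (v : B) (hv : v ∈ unitary B) (hv₂ : v * v = 1)
    (hcov : ∀ a, v * φ a = φ (σ a) * v) (a : A) :
    lift σ hσ φ v hv hv₂ hcov (ι σ hσ a) = φ a :=
  UniversalCStarAlgebra.lift_of (fun x : Option A => x.elim v φ) _ (some a)

theorem lift_w (φ : A →⋆ₐ[ℂ] B) (v : B) (hv : v ∈ unitary B) (hv₂ : v * v = 1)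
    (hcov : ∀ a, v * φ a = φ (σ a) * v) :
    lift σ hσ φ v hv hv₂ hcov (w σ hσ) = v :=
  UniversalCStarAlgebra.lift_of (fun x : Option A => x.elim v φ) _ none

theorem hom_ext {φ ψ : CrossedProduct σ hσ →⋆ₐ[ℂ] B} (h : ∀ a, φ (ι σ hσ a) = ψ (ι σ hσ a))
    (hw : φ (w σ hσ) = ψ (w σ hσ)) : φ = ψ :=
  UniversalCStarAlgebra.hom_ext (by
    rintro (_ | a)
    · exact hw
    · exact h a)

end CrossedProduct

/-- The fixed-point C*-algebra `{a | σ a = a}` of an automorphism `σ`. -/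
def fixedPointAlgebra (σ : A ≃⋆ₐ[ℂ] A) : StarSubalgebra ℂ A where
  carrier := {a | σ a = a}
  mul_mem' {a b} ha hb := (map_mul σ a b).trans (congrArg₂ _ ha hb)
  add_mem' {a b} ha hb := (map_add σ a b).trans (congrArg₂ _ ha hb)
  algebraMap_mem' c := AlgHomClass.commutes σ c
  star_mem' {a} ha := (map_star σ a).trans (congrArg star ha)

theorem mem_fixedPointAlgebra (σ : A ≃⋆ₐ[ℂ] A) (a : A) : a ∈ fixedPointAlgebra σ ↔ σ a = a :=
  Iff.rfl

end CrossedProduct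

/-! Since `w s₀ w = s₁` in the crossed product, that algebra is generated by the isometry `s₀` and
the self-adjoint unitary `w`, subject to `s₀` and `w s₀ w` being a Cuntz pair. Such data amount to
another Cuntz pair. Compressing `s₀` to the spectral projections of `w` gives `T± = (1 ± w) s₀ /
√2`, a Cuntz pair whose range projections are those spectral projections
(`IsCuntzPair.compression`). Conversely, a pair `T±` returns `w = T₊ T₊* - T₋ T₋*` and `s₀ = (T₊ +
T₋) / √2` (`IsCuntzPair.mean`). The universal properties turn this into mutually inverse
homomorphisms, which give `τ`.

The dual action fixes `s₀` and negates `w`, so it exchanges `T₊` and `T₋`: through `τ` it becomes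
the flip (`crossedEquiv_dual`). It remains to see that the fixed points of the dual action are the
canonical copy of `𝒪₂` (`dual_eq_self_iff`). Averaging over the dual action sends `a + b w` to `a`;
such elements are dense, and the copy is closed once `ι` is injective.

Injectivity (`ι_injective`) comes from the regular representation, placed inside `𝒪₂` by means of
`M₂(𝒪₂) ≅ 𝒪₂`: `a` acts as `diag(a, σ(a))` and `w` as the permutation matrix. -/

/-! ### Pairs of isometries with the Cuntz relation -/

section CuntzPair

variable {B : Type*} [CStarAlgebra B]

/-- Two isometries `a`, `b` with `a a* + b b* = 1`. -/
structure IsCuntzPair (a b : B) : Prop where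
  left : star a * a = 1
  right : star b * b = 1
  sum : a * star a + b * star b = 1

/-- The self-adjoint unitary `a a* - b b*`. -/
def rangeReflection (a b : B) : B := a * star a - b * star b

namespace IsCuntzPair

variable {a b : B}

/-- Multiplying the sum relation by `a*` on the left and `b` on the right gives `a* b = a* b + a*
b`. -/
theorem star_left_mul_right (h : IsCuntzPair a b) : star a * b = 0 := by
  have e : star a * (a * star a + b * star b) * b = star a * b := by rw [h.sum, mul_one]
  have e' : star a * (a * star a + b * star b) * b
      = (star a * a) * (star a * b) + (star a * b) * (star b * b) := by noncomm_ring
  rw [e', h.left, h.right, one_mul, mul_one] at e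
  simpa using e

theorem star_right_mul_left (h : IsCuntzPair a b) : star b * a = 0 := by
  simpa using congrArg star h.star_left_mul_right

theorem reflection_mul_left (h : IsCuntzPair a b) : rangeReflection a b * a = a := by
  rw [rangeReflection, sub_mul, mul_assoc, mul_assoc, h.left, h.star_right_mul_left]; simp

theorem reflection_mul_right (h : IsCuntzPair a b) : rangeReflection a b * b = -b := by
  rw [rangeReflection, sub_mul, mul_assoc, mul_assoc, h.right, h.star_left_mul_right]; simp

theorem star_reflection (a b : B) : star (rangeReflection a b) = rangeReflection a b := by
  simp [rangeReflection]

theorem reflection_mul_self (h : IsCuntzPair a b) :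
    rangeReflection a b * rangeReflection a b = 1 := by
  have e : rangeReflection a b * (a * star a - b * star b) = 1 := by
    rw [mul_sub, ← mul_assoc, ← mul_assoc, h.reflection_mul_left, h.reflection_mul_right, neg_mul,
      sub_neg_eq_add, h.sum]
  exact e

theorem reflection_mem_unitary (h : IsCuntzPair a b) : rangeReflection a b ∈ unitary B := by
  constructor <;> rw [star_reflection, h.reflection_mul_self]

/-- The mean `(a + b) / √2` and its conjugate by the reflection form a Cuntz pair. -/
theorem mean (h : IsCuntzPair a b) {c : ℂ} (hc : star c = c) (hc₂ : c * c = 1 / 2) :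
    IsCuntzPair (c • (a + b)) (rangeReflection a b * (c • (a + b)) * rangeReflection a b) := by
  set v := rangeReflection a b with hv
  have hsv : star v = v := star_reflection a b
  have hvv : v * v = 1 := h.reflection_mul_self
  have hva : v * (c • (a + b)) = c • (a - b) := by
    rw [mul_smul_comm, mul_add, h.reflection_mul_left, h.reflection_mul_right, sub_eq_add_neg]
  have h₁ : star (c • (a + b)) * (c • (a + b)) = 1 := by
    rw [star_smul, hc, smul_mul_smul_comm, star_add, add_mul, mul_add, mul_add, h.left, h.right,
      h.star_left_mul_right, h.star_right_mul_left, hc₂]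
    module
  refine ⟨h₁, ?_, ?_⟩
  · rw [star_mul, star_mul, hsv]
    calc v * (star (c • (a + b)) * v) * (v * (c • (a + b)) * v)
        = v * (star (c • (a + b)) * ((v * v) * (c • (a + b)))) * v := by simp only [mul_assoc]
      _ = 1 := by rw [hvv, one_mul, h₁, mul_one, hvv]
  -- The second isometry is `c (a - b) v`, with range projection `(a - b)(a - b)* / 2`. Added to `(a
  -- + b)(a + b)* / 2`, its cross terms cancel and `a a* + b b*` remains.
  · rw [hva, star_mul, hsv]
    have : c • (a - b) * v * (v * star (c • (a - b))) = c • (a - b) * star (c • (a - b)) := by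
      rw [mul_assoc, ← mul_assoc v, hvv, one_mul]
    rw [this, star_smul, star_smul, hc, smul_mul_smul_comm, smul_mul_smul_comm, hc₂, ← h.sum]
    simp only [star_add, star_sub, add_mul, mul_add, sub_mul, mul_sub]
    module

/-- The compressions `√2 p S` of an isometry `S` to the spectral projections `p = (1 ± w) / 2` of a
self-adjoint unitary `w` with `w S w* = S'`, where `S`, `S'` is a Cuntz pair. -/
theorem compression {S S' w : B} (h : IsCuntzPair S S') (hw : star w = w) (hw₂ : w * w = 1)
    (hS : w * S = S' * w) {c : ℂ} (hc : star c = c) (hc₂ : c * c = 1 / 2) :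
    IsCuntzPair (c • (S + S' * w)) (c • (S - S' * w)) ∧
      rangeReflection (c • (S + S' * w)) (c • (S - S' * w)) = w := by
  -- `S` and `S' w` are isometries with orthogonal ranges, so `c (S ± S' w)` are isometries as well.
  have e₁ : star S * (S' * w) = 0 := by rw [← mul_assoc, h.star_left_mul_right, zero_mul]
  have e₂ : w * star S' * S = 0 := by rw [mul_assoc, h.star_right_mul_left, mul_zero]
  have e₃ : w * star S' * (S' * w) = 1 := by
    rw [mul_assoc, ← mul_assoc (star S'), h.right, one_mul, hw₂]
  have e₄ : S' * w * (w * star S') = S' * star S' := by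
    rw [mul_assoc, ← mul_assoc w, hw₂, one_mul]
  -- The adjoint of `w S = S' w` is `S* w = w S'*`. This brings the cross terms of the range
  -- projections to the form (projection) times `w`.
  have e₅ : S * (w * star S') = S * star S * w := by
    have := congrArg star hS
    rw [star_mul, star_mul, hw] at this
    rw [← this, mul_assoc]
  have e₆ : S' * w * star S = S' * star S' * w := by
    have := congrArg star hS
    rw [star_mul, star_mul, hw] at this
    have e : w * star S = star S' * w := by
      calc w * star S = w * (star S * w) * w := by
            rw [mul_assoc, mul_assoc, hw₂, mul_one]
        _ = star S' * w := by rw [this, ← mul_assoc, hw₂, one_mul]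
    rw [mul_assoc, e, mul_assoc]
  -- The two cross terms add up to `w`. They cancel in the sum of the range projections and survive
  -- in the difference, which is therefore `w`.
  have hsum : S * star S * w + S' * star S' * w = w := by rw [← add_mul, h.sum, one_mul]
  refine ⟨⟨?_, ?_, ?_⟩, ?_⟩
  · simp only [star_smul, hc, smul_mul_smul_comm, hc₂, star_add, star_mul, hw, add_mul, mul_add,
      h.left, e₁, e₂, e₃]
    module
  · simp only [star_smul, hc, smul_mul_smul_comm, hc₂, star_sub, star_mul, hw, sub_mul, mul_sub,
      h.left, e₁, e₂, e₃]
    module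
  · simp only [star_smul, hc, smul_mul_smul_comm, hc₂, star_add, star_sub, star_mul, hw, sub_mul,
      mul_sub, add_mul, mul_add, e₄, e₅, e₆]
    rw [← h.sum]
    module
  · simp only [rangeReflection, star_smul, hc, smul_mul_smul_comm, hc₂, star_add, star_sub,
      star_mul, hw, sub_mul, mul_sub, add_mul, mul_add, e₄, e₅, e₆]
    conv_rhs => rw [← hsum]
    module

end IsCuntzPair

end CuntzPair

/-! ### Crossed products by `ℤ₂`: the dual action and its fixed points -/

namespace CrossedProduct

open UniversalCStarAlgebra (coeHom)


variable {A : Type*} [CStarAlgebra A] (σ : A ≃⋆ₐ[ℂ] A) (hσ : Function.Involutive σ)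

theorem star_w : star (w σ hσ) = w σ hσ := by
  rw [← mul_one (star (w σ hσ)), ← w_mul_w σ hσ, ← mul_assoc, (w_mem_unitary σ hσ).1, one_mul]

theorem w_mul_ι_mul_w (a : A) : w σ hσ * ι σ hσ a * w σ hσ = ι σ hσ (σ a) := by
  rw [w_mul_ι, mul_assoc, w_mul_w, mul_one]

theorem neg_w_mem_unitary : -w σ hσ ∈ unitary (CrossedProduct σ hσ) := by
  constructor <;> rw [star_neg, neg_mul_neg, star_w, w_mul_w]

/-- The dual action: `w ↦ -w`, the identity on `A`. -/
noncomputable def dual : CrossedProduct σ hσ →⋆ₐ[ℂ] CrossedProduct σ hσ :=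
  lift σ hσ (ι σ hσ) (-w σ hσ) (neg_w_mem_unitary σ hσ)
    (by rw [neg_mul_neg, w_mul_w]) fun a => by rw [neg_mul, mul_neg, w_mul_ι]

theorem dual_ι (a : A) : dual σ hσ (ι σ hσ a) = ι σ hσ a := lift_ι ..

theorem dual_w : dual σ hσ (w σ hσ) = -w σ hσ := lift_w ..

/-- On the *-algebra generated by `A` and `w`, every element has the form `a + b w`. -/
theorem exists_coeHom_eq (x : FreeStarAlgebra (Option A)) :
    ∃ a b : A, (coeHom (crossedRelations σ) x : CrossedProduct σ hσ) =
      ι σ hσ a + ι σ hσ b * w σ hσ := by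
  let q : FreeStarAlgebra (Option A) →⋆ₐ[ℂ] CrossedProduct σ hσ := coeHom (crossedRelations σ)
  change ∃ a b : A, q x = _
  induction x using FreeStarAlgebra.induction with
  | scalar c =>
    exact ⟨algebraMap ℂ A c, 0, by simp only [AlgHomClass.commutes, map_zero, zero_mul, add_zero]⟩
  | letter y =>
    have hn : q (FreeStarAlgebra.letter (none, false)) = w σ hσ := rfl
    have hs : ∀ a, q (FreeStarAlgebra.letter (some a, false)) = ι σ hσ a := fun _ => rfl
    have ht : ∀ z, q (FreeStarAlgebra.letter (z, true)) =
        star (q (FreeStarAlgebra.letter (z, false))) := fun z => by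
      rw [← map_star, FreeStarAlgebra.star_letter, Bool.not_false]
    obtain ⟨_ | a, _ | _⟩ := y
    · exact ⟨0, 1, by simp [hn]⟩
    · exact ⟨0, 1, by simp [ht, hn, star_w]⟩
    · exact ⟨a, 0, by simp [hs]⟩
    · exact ⟨star a, 0, by simp [ht, hs, map_star]⟩
  | mul x y hx hy =>
    obtain ⟨a, b, hx⟩ := hx
    obtain ⟨a', b', hy⟩ := hy
    -- Moving `w` to the right by `w a' = σ(a') w` and `w b' w = σ(b')`.
    refine ⟨a * a' + b * σ b', a * b' + b * σ a', ?_⟩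
    rw [map_mul, hx, hy]
    have e : ι σ hσ b * w σ hσ * (ι σ hσ b' * w σ hσ) = ι σ hσ b * ι σ hσ (σ b') := by
      rw [← w_mul_ι_mul_w]; simp only [mul_assoc]
    have e' : ι σ hσ b * w σ hσ * ι σ hσ a' = ι σ hσ b * ι σ hσ (σ a') * w σ hσ := by
      rw [mul_assoc, w_mul_ι, mul_assoc]
    rw [add_mul, mul_add, mul_add, e, e']
    simp only [map_add, map_mul, add_mul, mul_assoc]
    abel
  | add x y hx hy =>
    obtain ⟨a, b, hx⟩ := hx
    obtain ⟨a', b', hy⟩ := hy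
    refine ⟨a + a', b + b', ?_⟩
    rw [map_add, hx, hy]
    simp only [map_add, add_mul]
    abel

/-- The fixed points of the dual action are the canonical copy of `A`, if that copy is faithful. -/
theorem dual_eq_self_iff (hι : Function.Injective (ι σ hσ)) (x : CrossedProduct σ hσ) :
    dual σ hσ x = x ↔ x ∈ Set.range (ι σ hσ) := by
  -- An injective *-homomorphism of C*-algebras is isometric, so its range is complete, hence
  -- closed.
  have hclosed : IsClosed (Set.range (ι σ hσ)) :=
    (NonUnitalStarAlgHom.isometry (ι σ hσ) hι).isClosedEmbedding.isClosed_range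
  have hcont : Continuous (dual σ hσ) := AddMonoidHomClass.continuous_of_bound _ 1 fun a => by
    rw [one_mul]; exact NonUnitalStarAlgHom.norm_apply_le (dual σ hσ) a
  -- Averaging over the dual action kills the `w` part of `a + b w`. By continuity and closedness of
  -- the range it is enough to check this on the dense subalgebra.
  have key : ∀ x : CrossedProduct σ hσ,
      (1 / 2 : ℂ) • (x + dual σ hσ x) ∈ Set.range (ι σ hσ) := fun x => by
    refine UniversalCStarAlgebra.induction_on (crossedRelations σ)
      (motive := fun x : CrossedProduct σ hσ =>
        (1 / 2 : ℂ) • (x + dual σ hσ x) ∈ Set.range (ι σ hσ)) x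
      (hclosed.preimage ((continuous_id.add hcont).const_smul (1 / 2 : ℂ))) fun y => ?_
    let q : CrossedProduct σ hσ := coeHom (crossedRelations σ) y
    obtain ⟨a, b, h⟩ : ∃ a b, q = ι σ hσ a + ι σ hσ b * w σ hσ := exists_coeHom_eq σ hσ y
    refine ⟨a, ?_⟩
    change ι σ hσ a = (1 / 2 : ℂ) • (q + dual σ hσ q)
    rw [h, map_add, map_mul, dual_ι, dual_ι, dual_w, mul_neg]
    module
  constructor
  -- A fixed point equals its own average.
  · intro h
    have := key x
    rw [h] at this
    convert this using 1
    module
  · rintro ⟨a, rfl⟩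
    exact dual_ι σ hσ a


end CrossedProduct

/-! ### The crossed product of `𝒪₂` by the flip -/

namespace CuntzTwo

open CrossedProduct

theorem isCuntzPair : IsCuntzPair (s 0) (s 1) := ⟨star_s_mul_s 0, star_s_mul_s 1, s_mul_star_s⟩

/-- `lift` for a Cuntz pair. -/
noncomputable def liftPair {B : Type*} [CStarAlgebra B] {a b : B} (h : IsCuntzPair a b) :
    CuntzTwo →⋆ₐ[ℂ] B :=
  lift ![a, b] (Fin.forall_fin_two.2 ⟨h.left, h.right⟩) h.sum

section liftPair

variable {B : Type*} [CStarAlgebra B] {a b : B} (h : IsCuntzPair a b)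

theorem liftPair_s_zero : liftPair h (s 0) = a := lift_s ..

theorem liftPair_s_one : liftPair h (s 1) = b := lift_s ..

theorem hom_ext_pair {φ ψ : CuntzTwo →⋆ₐ[ℂ] B} (h₀ : φ (s 0) = ψ (s 0)) (h₁ : φ (s 1) = ψ (s 1)) :
    φ = ψ :=
  hom_ext (Fin.forall_fin_two.2 ⟨h₀, h₁⟩)

/-- Covariance with respect to the flip can be checked on the generator `s₀`. -/
theorem covariant_of_s_zero (φ : CuntzTwo →⋆ₐ[ℂ] B) {v : B} (hv : star v = v) (hv₂ : v * v = 1)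
    (hs : v * φ (s 0) = φ (s 1) * v) (a : CuntzTwo) : v * φ a = φ (σ a) * v := by
  let u : unitary B := ⟨v, by rw [hv, hv₂], by rw [hv, hv₂]⟩
  have hu : ∀ x, Unitary.conjStarAlgAut ℂ B u x = v * x * v := fun x => by
    rw [Unitary.conjStarAlgAut_apply]
    change v * x * star v = _
    rw [hv]
  -- Conjugation by `v` is a *-automorphism, so both sides are determined on generators. The
  -- relation at `s₁` follows from the one at `s₀` because `v² = 1`.
  have e : (Unitary.conjStarAlgAut ℂ B u : B →⋆ₐ[ℂ] B).comp φ =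
      φ.comp (σ : CuntzTwo →⋆ₐ[ℂ] CuntzTwo) := hom_ext_pair
    (by
      change Unitary.conjStarAlgAut ℂ B u (φ (s 0)) = φ (σ (s 0))
      rw [hu, hs, mul_assoc, hv₂, mul_one, σ_s_zero])
    (by
      change Unitary.conjStarAlgAut ℂ B u (φ (s 1)) = φ (σ (s 1))
      rw [hu, mul_assoc, ← hs, ← mul_assoc, hv₂, one_mul, σ_s_one])
  have ea : v * φ a * v = φ (σ a) := (hu _).symm.trans (DFunLike.congr_fun e a)
  rw [← ea, mul_assoc, hv₂, mul_one]

end liftPair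

/-- The crossed product of `𝒪₂` by the flip. -/
abbrev FlipCrossedProduct : Type := CrossedProduct σ σ_involutive

/-- A *-homomorphism on the crossed product is determined by its values at `s₀` and `w`. -/
theorem crossed_hom_ext {B : Type*} [CStarAlgebra B] {φ ψ : FlipCrossedProduct →⋆ₐ[ℂ] B}
    (hs : φ (ι σ σ_involutive (s 0)) = ψ (ι σ σ_involutive (s 0)))
    (hw : φ (w σ σ_involutive) = ψ (w σ σ_involutive)) : φ = ψ := by
  refine CrossedProduct.hom_ext σ σ_involutive (fun a => ?_) hw
  refine DFunLike.congr_fun (f := φ.comp (ι σ σ_involutive)) (g := ψ.comp (ι σ σ_involutive))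
    (hom_ext_pair hs ?_) a
  change φ (ι σ σ_involutive (s 1)) = ψ (ι σ σ_involutive (s 1))
  -- `s₁ = σ(s₀)` is implemented as `w s₀ w`, so its image is already determined.
  rw [← σ_s_zero, ← w_mul_ι_mul_w]
  simp only [map_mul, hs, hw]

theorem isCuntzPair_ι :
    IsCuntzPair (ι σ σ_involutive (s 0)) (ι σ σ_involutive (s 1)) where
  left := by rw [← map_star, ← map_mul, isCuntzPair.left, map_one]
  right := by rw [← map_star, ← map_mul, isCuntzPair.right, map_one]
  sum := by
    rw [← map_star, ← map_star, ← map_mul, ← map_mul, ← map_add, isCuntzPair.sum, map_one]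

/-! ### Mutually inverse homomorphisms and the dual action -/

/-- The scalar `1 / √2`. -/
noncomputable def invSqrtTwo : ℂ := ((√2)⁻¹ : ℝ)

theorem star_invSqrtTwo : star invSqrtTwo = invSqrtTwo := Complex.conj_ofReal _

theorem invSqrtTwo_mul_self : invSqrtTwo * invSqrtTwo = 1 / 2 := by
  rw [invSqrtTwo, ← Complex.ofReal_mul, ← mul_inv, Real.mul_self_sqrt zero_le_two]
  norm_num

/-- The *-homomorphism `𝒪₂ ⋊ ℤ₂ → 𝒪₂` with `s₀ ↦ (s₀ + s₁) / √2` and `w ↦ s₀ s₀* - s₁ s₁*`. -/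
noncomputable def crossedToCuntz : FlipCrossedProduct →⋆ₐ[ℂ] CuntzTwo :=
  CrossedProduct.lift σ σ_involutive
    (liftPair (isCuntzPair.mean star_invSqrtTwo invSqrtTwo_mul_self))
    (rangeReflection (s 0) (s 1)) isCuntzPair.reflection_mem_unitary
    isCuntzPair.reflection_mul_self
    (covariant_of_s_zero _ (IsCuntzPair.star_reflection _ _) isCuntzPair.reflection_mul_self (by
      rw [liftPair_s_zero, liftPair_s_one, mul_assoc _ (rangeReflection _ _),
        isCuntzPair.reflection_mul_self, mul_one]))

theorem crossedToCuntz_s_zero :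
    crossedToCuntz (ι σ σ_involutive (s 0)) = invSqrtTwo • (s 0 + s 1) :=
  (CrossedProduct.lift_ι ..).trans (liftPair_s_zero _)

theorem crossedToCuntz_w : crossedToCuntz (w σ σ_involutive) = rangeReflection (s 0) (s 1) :=
  CrossedProduct.lift_w ..

/-- These are the elements `(1 ± w) s₀ / √2`, with `w s₀` rewritten as `s₁ w`. -/
theorem compression_ι :
    IsCuntzPair
        (invSqrtTwo • (ι σ σ_involutive (s 0) + ι σ σ_involutive (s 1) * w σ σ_involutive))
        (invSqrtTwo • (ι σ σ_involutive (s 0) - ι σ σ_involutive (s 1) * w σ σ_involutive)) ∧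
      rangeReflection
        (invSqrtTwo • (ι σ σ_involutive (s 0) + ι σ σ_involutive (s 1) * w σ σ_involutive))
        (invSqrtTwo • (ι σ σ_involutive (s 0) - ι σ σ_involutive (s 1) * w σ σ_involutive)) =
      w σ σ_involutive :=
  isCuntzPair_ι.compression (star_w ..) (w_mul_w ..) (by rw [w_mul_ι, σ_s_zero])
    star_invSqrtTwo invSqrtTwo_mul_self

/-- The *-homomorphism `𝒪₂ → 𝒪₂ ⋊ ℤ₂` with `s₀ ↦ (1 + w) s₀ / √2` and `s₁ ↦ (1 - w) s₀ / √2`. -/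
noncomputable def cuntzToCrossed : CuntzTwo →⋆ₐ[ℂ] FlipCrossedProduct := liftPair compression_ι.1

/-- The two compressions of `s₀` add up to `√2 s₀`, and their range reflection is `w`. -/
theorem cuntzToCrossed_crossedToCuntz :
    cuntzToCrossed.comp crossedToCuntz = StarAlgHom.id ℂ FlipCrossedProduct := by
  apply crossed_hom_ext
  · change cuntzToCrossed (crossedToCuntz (ι σ σ_involutive (s 0))) = ι σ σ_involutive (s 0)
    rw [crossedToCuntz_s_zero, map_smul, map_add, cuntzToCrossed, liftPair_s_zero, liftPair_s_one,
      ← smul_add, smul_smul, invSqrtTwo_mul_self]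
    module
  · change cuntzToCrossed (crossedToCuntz (w σ σ_involutive)) = w σ σ_involutive
    rw [crossedToCuntz_w, ← compression_ι.2]
    simp only [rangeReflection, map_sub, map_mul, map_star]
    rw [cuntzToCrossed, liftPair_s_zero, liftPair_s_one]

theorem crossedToCuntz_cuntzToCrossed :
    crossedToCuntz.comp cuntzToCrossed = StarAlgHom.id ℂ CuntzTwo := by
  -- Since `s₁ w = w s₀`, the image is the reflection applied to `(s₀ + s₁) / √2`, which changes the
  -- sign of `s₁`.
  have e : crossedToCuntz (ι σ σ_involutive (s 1) * w σ σ_involutive) =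
      invSqrtTwo • (s 0 - s 1) := by
    nth_rw 1 [← σ_s_zero]
    rw [← w_mul_ι, map_mul, crossedToCuntz_w, crossedToCuntz_s_zero, mul_smul_comm,
      mul_add, isCuntzPair.reflection_mul_left, isCuntzPair.reflection_mul_right, sub_eq_add_neg]
  apply hom_ext_pair
  · change crossedToCuntz (cuntzToCrossed (s 0)) = s 0
    rw [cuntzToCrossed, liftPair_s_zero, map_smul, map_add, crossedToCuntz_s_zero, e, ← smul_add,
      smul_smul, invSqrtTwo_mul_self]
    module
  · change crossedToCuntz (cuntzToCrossed (s 1)) = s 1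
    rw [cuntzToCrossed, liftPair_s_one, map_smul, map_sub, crossedToCuntz_s_zero, e, ← smul_sub,
      smul_smul, invSqrtTwo_mul_self]
    module

/-- The isomorphism `𝒪₂ ⋊ ℤ₂ ≃ 𝒪₂`. -/
noncomputable def crossedEquiv : FlipCrossedProduct ≃⋆ₐ[ℂ] CuntzTwo :=
  StarAlgEquiv.ofStarAlgHom crossedToCuntz cuntzToCrossed cuntzToCrossed_crossedToCuntz
    crossedToCuntz_cuntzToCrossed

/-- The isomorphism intertwines the dual action and the flip. -/
theorem crossedEquiv_dual (x : FlipCrossedProduct) :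
    crossedEquiv (dual σ σ_involutive x) = σ (crossedEquiv x) := by
  -- The image of `s₀` is symmetric in the two generators of `𝒪₂`, the image of `w` antisymmetric.
  refine DFunLike.congr_fun (f := crossedToCuntz.comp (dual σ σ_involutive))
    (g := (σ : CuntzTwo →⋆ₐ[ℂ] CuntzTwo).comp crossedToCuntz) (crossed_hom_ext ?_ ?_) x
  · change crossedToCuntz (dual σ σ_involutive _) = σ (crossedToCuntz _)
    rw [dual_ι, crossedToCuntz_s_zero, map_smul, map_add, σ_s_zero, σ_s_one, add_comm]
  · change crossedToCuntz (dual σ σ_involutive _) = σ (crossedToCuntz _)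
    rw [dual_w, map_neg, crossedToCuntz_w, rangeReflection, map_sub, map_mul, map_mul, map_star,
      map_star, σ_s_zero, σ_s_one, neg_sub]

/-! ### Faithfulness of the canonical copy -/

/-- The covariant representation `a ↦ s₀ a s₀* + s₁ σ(a) s₁*` of `𝒪₂` on itself. -/
noncomputable def amplification : CuntzTwo →⋆ₐ[ℂ] CuntzTwo where
  toFun a := s 0 * a * star (s 0) + s 1 * σ a * star (s 1)
  map_one' := by simpa using s_mul_star_s
  map_mul' a b := by
    have e₁ : star (s 0) * (s 0 * (b * star (s 0))) = b * star (s 0) := by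
      rw [← mul_assoc, isCuntzPair.left, one_mul]
    have e₂ : star (s 1) * (s 1 * (σ b * star (s 1))) = σ b * star (s 1) := by
      rw [← mul_assoc, isCuntzPair.right, one_mul]
    have e₃ : star (s 0) * (s 1 * (σ b * star (s 1))) = 0 := by
      rw [← mul_assoc, isCuntzPair.star_left_mul_right, zero_mul]
    have e₄ : star (s 1) * (s 0 * (b * star (s 0))) = 0 := by
      rw [← mul_assoc, isCuntzPair.star_right_mul_left, zero_mul]
    simp only [map_mul, add_mul, mul_add, mul_assoc, e₁, e₂, e₃, e₄, mul_zero, add_zero, zero_add]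
  map_zero' := by simp
  map_add' a b := by
    simp only [map_add, mul_add, add_mul]
    abel
  commutes' c := by
    rw [AlgHomClass.commutes σ c, Algebra.algebraMap_eq_smul_one]
    simp only [mul_smul_comm, smul_mul_assoc, mul_one]
    rw [← smul_add, s_mul_star_s]
  map_star' a := by simp [map_star, mul_assoc]

theorem amplification_apply (a : CuntzTwo) :
    amplification a = s 0 * a * star (s 0) + s 1 * σ a * star (s 1) := rfl

theorem amplification_injective : Function.Injective amplification := by
  refine Function.LeftInverse.injective (g := fun x => star (s 0) * x * s 0) fun a => ?_
  change star (s 0) * amplification a * s 0 = a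
  calc star (s 0) * amplification a * s 0
      = (star (s 0) * s 0) * a * (star (s 0) * s 0) +
        (star (s 0) * s 1) * σ a * (star (s 1) * s 0) := by
        rw [amplification_apply]; noncomm_ring
    _ = a := by
        rw [isCuntzPair.left, isCuntzPair.star_left_mul_right]; simp

/-- The faithful representation `amplification` is part of a covariant pair, so it factors through
`ι`. -/
theorem ι_injective : Function.Injective (ι σ σ_involutive) := by
  -- The permutation matrix in the matrix units `sᵢ sⱼ*`. It exchanges the diagonal entries `a` and
  -- `σ(a)`, and `diag(σ(a), a)` is the amplification of `σ(a)` because `σ² = id`.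
  let v : CuntzTwo := s 0 * star (s 1) + s 1 * star (s 0)
  have e : ∀ (i j : Fin 2) (x : CuntzTwo), star (s i) * (s j * x) = if i = j then x else 0 := by
    intro i j x
    rw [← mul_assoc]
    fin_cases i <;> fin_cases j <;>
      simp [isCuntzPair.left, isCuntzPair.right, isCuntzPair.star_left_mul_right,
        isCuntzPair.star_right_mul_left]
  have hv : star v = v := by simp [v, add_comm]
  have hv₂ : v * v = 1 := by
    simp only [v, mul_add, add_mul, mul_assoc, e]
    simpa [add_comm] using s_mul_star_s
  have hcov : ∀ a, v * amplification a = amplification (σ a) * v := fun a => by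
    simp only [v, amplification_apply, σ_involutive a, mul_add, add_mul, mul_assoc, e]
    simp [add_comm]
  let Φ := CrossedProduct.lift σ σ_involutive amplification v
    ⟨by rw [hv, hv₂], by rw [hv, hv₂]⟩ hv₂ hcov
  refine Function.Injective.of_comp (f := Φ) ?_
  have : Φ ∘ ι σ σ_involutive = amplification := funext fun a => CrossedProduct.lift_ι ..
  rw [this]
  exact amplification_injective

/-! ### Identification with the fixed-point algebra -/

/-- The copy of `𝒪₂` in the crossed product corresponds to the fixed-point algebra of the flip. -/
theorem crossedEquiv_mem_fixedPointAlgebra (x : FlipCrossedProduct) :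
    crossedEquiv x ∈ fixedPointAlgebra σ ↔ x ∈ Set.range (ι σ σ_involutive) := by
  -- Being fixed by the flip pulls back to being fixed by the dual action.
  rw [mem_fixedPointAlgebra, ← crossedEquiv_dual, (EquivLike.injective crossedEquiv).eq_iff,
    dual_eq_self_iff σ σ_involutive ι_injective]

/-- The isomorphism of `𝒪₂` with the fixed-point algebra of the flip. -/
noncomputable def fixedPointEquiv : CuntzTwo ≃⋆ₐ[ℂ] fixedPointAlgebra σ :=
  StarAlgEquiv.ofBijective
    (StarAlgHom.codRestrict (crossedToCuntz.comp (ι σ σ_involutive)) (fixedPointAlgebra σ)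
      fun a => (crossedEquiv_mem_fixedPointAlgebra _).2 ⟨a, rfl⟩)
    -- For surjectivity, the preimage of a flip-fixed element under the isomorphism lies in the
    -- canonical copy.
    ⟨fun _ _ h => ι_injective (EquivLike.injective crossedEquiv (congrArg Subtype.val h)), fun y => by
      obtain ⟨x, hx⟩ := EquivLike.surjective crossedEquiv y.1
      obtain ⟨a, rfl⟩ := (crossedEquiv_mem_fixedPointAlgebra x).1 (hx ▸ y.2)
      exact ⟨a, Subtype.ext hx⟩⟩

theorem coe_fixedPointEquiv (a : CuntzTwo) :
    (fixedPointEquiv a : CuntzTwo) = crossedEquiv (ι σ σ_involutive a) := rfl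

end CuntzTwo

theorem mainTheorem5 :
    ∃ τ : CrossedProduct CuntzTwo.σ CuntzTwo.σ_involutive ≃⋆ₐ[ℂ] CuntzTwo,
      τ '' Set.range (CrossedProduct.ι CuntzTwo.σ CuntzTwo.σ_involutive) =
          fixedPointAlgebra CuntzTwo.σ ∧
        ∃ θ : CuntzTwo ≃⋆ₐ[ℂ] fixedPointAlgebra CuntzTwo.σ,
          ∀ a : CuntzTwo,
            (θ a : CuntzTwo) = τ (CrossedProduct.ι CuntzTwo.σ CuntzTwo.σ_involutive a) := by
  refine ⟨CuntzTwo.crossedEquiv, ?_, CuntzTwo.fixedPointEquiv, CuntzTwo.coe_fixedPointEquiv⟩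
  ext y
  obtain ⟨x, rfl⟩ := EquivLike.surjective CuntzTwo.crossedEquiv y
  rw [(EquivLike.injective CuntzTwo.crossedEquiv).mem_set_image]
  exact (CuntzTwo.crossedEquiv_mem_fixedPointAlgebra x).symm
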